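/- Let $A$ be a finite nonempty alphabet, $m$ a positive integer, and $(\mathbf M_a)_{a\in A}$ a family of nonnegative real $m\times m$ matrices. Vectors are row vectors, $\|\mathbf v\|=\sum_i|\mathbf v(i)|$, $\mathrm{supp}(\mathbf v)=\{i:\mathbf v(i)>0\}$, and for a word $w=a_1\cdots a_k$ let $\mathbf M_w=\mathbf M_{a_1}\cdots\mathbf M_{a_k}$ (the identity for the empty word). Assume that the family is superfair, i.e. $\frac1{|A|}\sum_{a\in A}\|\mathbf v\mathbf M_a\|\le\|\mathbf v\|$ for every $\mathbf v\ge\mathbf 0$, and that $(\bigstar)$ for all $i,j\in\{1,\dots,m\}$ there is a word $w\in A^*$ with $\mathbf M_w(i,j)>0$. Words act on vectors by $\mathbf v\cdot w=\mathbf v\mathbf M_w/\|\mathbf v\mathbf M_w\|$ (and $\mathbf v\cdot w=\mathbf 0$ if $\mathbf v\mathbf M_w=\mathbf 0$), and on subsets of $\{1,\dots,m\}$ by $E\cdot w=\mathrm{supp}(\mathbf v_E\mathbf M_w)$, where $\mathbf v_E$ is any nonnegative vector with support $E$. A word $w$ pseudo-mixes $E$ if $E\cdot w=E$ and, for each $i\in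 E$, $\{i\}\cdot w\in\{E,\emptyset\}$. Let $\hat{\mathfrak A}$ be the automaton with transitions $E\xrightarrow{a}E\cdot a$ whose states are the subsets of $\{1,\dots,m\}$ reachable from singletons. For $E\ne\emptyset$ let $\mathbf U^+(E)$ be the set of nonnegative vectors of norm $1$ with support exactly $E$, and for $\mathbf u,\mathbf v\in\mathbf U^+(E)$ let $d_H(\mathbf u,\mathbf v)=\ln\frac{\max_{i\in E}\mathbf u(i)/\mathbf v(i)}{\min_{i\in E}\mathbf u(i)/\mathbf v(i)}$. Suppose that $\hat{\mathfrak A}$ has a bottom strongly connected component $\mathfrak B\neq\{\emptyset\}$. Let $F\in\mathfrak B$, let $w$ be a word which pseudo-mixes $F$, and let $\mathbf x\in\mathbf U^+(F)$ be the vector for which there are $c>0$ and $\tau\in(0,1)$ with $d_H(\mathbf v\cdot w^k,\mathbf x)\le c\,\tau^k$ for all $k\ge1$ and all $\mathbf v\in\mathbf U^+(F)$. For $\mathbf u\ge\mathbf 0$, $\mathbf u\ne\mathbf 0$, let $\Delta(\mathbf u)=\min\bigl(1,\ \ln\|\mathbf u\|-\frac1{|A|}\sum_{a\in A}\ln\|\mathbf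 u\mathbf M_a\|\bigr)$ with $\ln 0=-\infty$. For $\mathbf v\ge\mathbf 0$ let $\mathrm{Live}(\mathbf v)=\|\mathbf v\|-\max\{\|\mathbf s\|:\mathbf s\in\mathcal S,\ \mathbf s\le\mathbf v\}$, where $\mathcal S=\{\mathbf s\ge\mathbf 0:\|\mathbf s\mathbf M_z\|=\|\mathbf s\|\text{ for all }z\in A^*\}$. A sequence $X\in A^{\mathbb N}$ is normal if every word $u$ occurs in it with asymptotic frequency $|A|^{-|u|}$. A real sequence $(x_n)$ converges exponentially fast to $l$ if $|x_n-l|=O(e^{-\alpha n})$ for some $\alpha>0$. **Proposition (Case 2).** If $\Delta(\mathbf x\cdot z)=0$ for every word $z\in A^*$, then: 1. for every normal $X$ and every starting vector $\mathbf v\ge\mathbf 0$, either $\mathbf v\mathbf M_{X[1..n]}=\mathbf 0$ for all sufficiently large $n$, or $\|\mathbf v\mathbf M_{X[1..n]}\|$ converges exponentially fast to a positive constant; 2. there is a vector $\mathbf v\ge\mathbf 0$ such that, for every normal $X$, $\|\mathbf v\mathbf M_{X[1..n]}\|$ converges exponentially fast to a positive constant; 3. for every normal $X$ and every $\mathbf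 v\ge\mathbf 0$, $\mathrm{Live}(\mathbf v\mathbf M_{X[1..n]})$ converges exponentially fast to $0$. -/

import Mathlib

open Filter Topology Asymptotics
open scoped Matrix

namespace MatrixWalk

noncomputable section

/-- The norm `‖v‖ = ∑ i, |v i|` of a row vector. -/
def l1Norm {m : ℕ} (v : Fin m → ℝ) : ℝ := ∑ i, |v i|

/-- The set of indices at which the vector is positive. -/
def supp {m : ℕ} (v : Fin m → ℝ) : Finset (Fin m) := {i | 0 < v i}

/-- Nonnegative vectors of norm `1` whose support is exactly `E`. -/
def unitVectors {m : ℕ} (E : Finset (Fin m)) : Set (Fin m → ℝ) :=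
  {v | 0 ≤ v ∧ l1Norm v = 1 ∧ supp v = E}

/-- The Hilbert projective metric
`ln (max_{i ∈ E} (u i / v i) / min_{i ∈ E} (u i / v i))`. It is only meaningful, and only used, for
nonnegative vectors `u`, `v` with the same nonempty support `E`. -/
def hilbertDist {m : ℕ} (u v : Fin m → ℝ) : ℝ :=
  Real.log ((⨆ i : supp u, u i / v i) / (⨅ i : supp u, u i / v i))

variable {A : Type*} {m : ℕ}

/-- `M_w = M_{a₁} ⋯ M_{aₖ}` for `w = a₁ … aₖ`; the empty word gives the identity matrix. -/
def wordMatrix (M : A → Matrix (Fin m) (Fin m) ℝ) (w : List A) : Matrix (Fin m) (Fin m) ℝ :=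
  (w.map M).prod

/-- The word `w` repeated `k` times. -/
def wordPow (w : List A) (k : ℕ) : List A := (List.replicate k w).flatten

/-- The prefix consisting of the first `n` letters of `X`; the letters of a sequence are indexed
from `0` here. -/
def seqPrefix (X : ℕ → A) (n : ℕ) : List A := (List.range n).map X

open Classical in
/-- The sequence `X` is normal: every word `w` occurs in `X` (overlaps allowed) with asymptotic
frequency `|A|^(-|w|)`. -/
def IsNormal [Fintype A] (X : ℕ → A) : Prop :=
  ∀ w : List A, Tendsto
    (fun n : ℕ =>
      (((Finset.range n).filter
        (fun i => ∀ (j : ℕ) (hj : j < w.length), X (i + j) = w[j])).card : ℝ) / (n : ℝ))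
    atTop (𝓝 (((Fintype.card A : ℝ) ^ w.length)⁻¹))

/-- `‖v‖ ≥ (∑ a, ‖v M_a‖) / |A|` for every nonnegative vector `v`. -/
def IsSuperfair [Fintype A] (M : A → Matrix (Fin m) (Fin m) ℝ) : Prop :=
  ∀ v : Fin m → ℝ, 0 ≤ v → (∑ a, l1Norm (v ᵥ* M a)) / (Fintype.card A : ℝ) ≤ l1Norm v

/-- For all indices `i`, `j` there is a word `w` with `M_w(i,j) > 0`. -/
def StarCondition (M : A → Matrix (Fin m) (Fin m) ℝ) : Prop :=
  ∀ i j : Fin m, ∃ w : List A, 0 < wordMatrix M w i j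

/-- The action of words on unit vectors and `0`: `v · w = v M_w / ‖v M_w‖`, and `v · w = 0` if
`v M_w = 0`. -/
def act (M : A → Matrix (Fin m) (Fin m) ℝ) (v : Fin m → ℝ) (w : List A) : Fin m → ℝ :=
  if v ᵥ* wordMatrix M w = 0 then 0
  else (l1Norm (v ᵥ* wordMatrix M w))⁻¹ • (v ᵥ* wordMatrix M w)

/-- The action of words on sets of indices: `E · w` is the support of `v M_w`, where `v` is a vector
with support `E` (here the indicator vector of `E`). -/
def setAct (M : A → Matrix (Fin m) (Fin m) ℝ) (E : Finset (Fin m)) (w : List A) :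
    Finset (Fin m) :=
  supp ((fun i => if i ∈ E then (1 : ℝ) else 0) ᵥ* wordMatrix M w)

/-- `w` pseudo-mixes `E`: `E · w = E`, and for each `i ∈ E`, `{i} · w` is either `E` or empty. -/
def PseudoMixes (M : A → Matrix (Fin m) (Fin m) ℝ) (w : List A) (E : Finset (Fin m)) : Prop :=
  setAct M E w = E ∧ ∀ i ∈ E, setAct M {i} w = E ∨ setAct M {i} w = ∅

/-- `B` is a bottom strongly connected component of the support automaton, whose states are the sets
of indices and whose transitions are `E → E · a`: it is nonempty, any two of its members are
connected by a path, and no transition leaves it (so that it is also maximal). -/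
def IsBSCC (M : A → Matrix (Fin m) (Fin m) ℝ) (B : Set (Finset (Fin m))) : Prop :=
  B.Nonempty ∧ (∀ E ∈ B, ∀ E' ∈ B, ∃ z : List A, setAct M E z = E') ∧
    ∀ E ∈ B, ∀ a : A, setAct M E [a] ∈ B

/-- The states of the support automaton that are reachable from singletons. -/
def singletonReachable (M : A → Matrix (Fin m) (Fin m) ℝ) : Set (Finset (Fin m)) :=
  {E | ∃ (i : Fin m) (z : List A), setAct M {i} z = E}

/-- `B` is a bottom strongly connected component, other than `{∅}`, of the sub-automaton of the
support automaton formed by the states reachable from singletons. That set of states is closed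
under transitions, so these are the components of the support automaton that lie in it. -/
def IsNonNullBSCC (M : A → Matrix (Fin m) (Fin m) ℝ) (B : Set (Finset (Fin m))) : Prop :=
  IsBSCC M B ∧ B ⊆ singletonReachable M ∧ B ≠ {∅}

/-- `x` is the unit vector of support `F` to which the powers of `w` contract all unit vectors of
support `F`, exponentially fast in the Hilbert metric. -/
def IsContractionLimit (M : A → Matrix (Fin m) (Fin m) ℝ) (F : Finset (Fin m)) (w : List A)
    (x : Fin m → ℝ) : Prop :=
  x ∈ unitVectors F ∧
    ∃ c > (0 : ℝ), ∃ τ ∈ Set.Ioo (0 : ℝ) 1, ∀ k : ℕ, 1 ≤ k → ∀ v ∈ unitVectors F,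
      hilbertDist (act M v (wordPow w k)) x ≤ c * τ ^ k

open Classical in
/-- The bounded risk `Δ(u) = min (1, ln ‖u‖ - (1/|A|) ∑ a, ln ‖u M_a‖)` with `ln 0 = -∞`, so that the
value is `1` as soon as some `u M_a` vanishes. -/
def risk [Fintype A] (M : A → Matrix (Fin m) (Fin m) ℝ) (u : Fin m → ℝ) : ℝ :=
  if ∃ a, l1Norm (u ᵥ* M a) = 0 then 1
  else min 1 (Real.log (l1Norm u) -
    (∑ a, Real.log (l1Norm (u ᵥ* M a))) / (Fintype.card A : ℝ))

/-- The cone of non-betting vectors. -/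
def nonBetting (M : A → Matrix (Fin m) (Fin m) ℝ) : Set (Fin m → ℝ) :=
  {v | 0 ≤ v ∧ ∀ z : List A, l1Norm (v ᵥ* wordMatrix M z) = l1Norm v}

/-- The live part `‖v‖ - max {‖s‖ | s non-betting, s ≤ v}` of a nonnegative vector `v`. The set is
nonempty and compact, so its supremum is its maximum. -/
def live (M : A → Matrix (Fin m) (Fin m) ℝ) (v : Fin m → ℝ) : ℝ :=
  l1Norm v - sSup (l1Norm '' {s | s ∈ nonBetting M ∧ s ≤ v})

/-- `u n` converges to `l` exponentially fast: `|u n - l| = O(exp (-α n))` for some `α > 0`. -/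
def ExpConvergesTo (u : ℕ → ℝ) (l : ℝ) : Prop :=
  ∃ α > (0 : ℝ), (fun n : ℕ => u n - l) =O[atTop] (fun n : ℕ => Real.exp (-α * (n : ℝ)))

/-- The vector `v M_{X[1..n]}`. -/
def orbit (M : A → Matrix (Fin m) (Fin m) ℝ) (v : Fin m → ℝ) (X : ℕ → A) (n : ℕ) : Fin m → ℝ :=
  v ᵥ* wordMatrix M (seqPrefix X n)

end

end MatrixWalk

open MatrixWalk

/-!
A unit vector `x` all of whose successors have risk `0` is non-betting: equality in Jensen's
inequality forces `‖x M_z‖ = 1` for every word `z` (`mem_nonBetting_of_risk`). The existence of one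
nonzero non-betting vector, with a support that is reachable from a singleton, is all that is needed
below; together with the condition `(★)` it implies that every basis vector `e_i` is taken by some
word to a vector that dominates a nonzero non-betting vector (`exists_word_hasNonBettingPart`).

The non-betting part of a vector contributes nothing to the live part at later times. Hence
`live (v M_w) ≤ (∑ i, live (e_i M_w)) * live v` (`live_vecMul_le_mul`), and, by superfairness, the
mean of `live (v M_w)` over the words `w` of a suitable fixed length is at most `q * live v` for
some `q < 1` (`exists_iterate_letterMean_live_le`). Iterating, the growth factors
`∑ i, live (e_i M_w)` have an arbitrarily small mean over the words of some length `k`, so their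
logarithms have a negative mean (`exists_sum_log_neg`). Along a normal sequence these means are the
limits of the means over the blocks of the sequence, and the live part decays exponentially fast
(`expConvergesTo_zero_of_le_mul`, `expConvergesTo_live_orbit`).

The norm changes in each step by at most a multiple of the live part
(`abs_l1Norm_vecMul_sub_le`), so it converges exponentially fast too. Finally there is a word `w`
such that each `e_i M_w` is `0` or dominates a nonzero non-betting vector (`exists_word_forall`).
It occurs in every normal sequence; after that the orbit is `0`, or its norm stays above a positive
constant.
-/

namespace MatrixWalk

variable {A : Type*} {m : ℕ}

/-! ### The norm and the word matrices on the nonnegative cone -/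

lemma l1Norm_eq_sum {v : Fin m → ℝ} (hv : 0 ≤ v) : l1Norm v = ∑ i, v i :=
  Finset.sum_congr rfl fun i _ => abs_of_nonneg (hv i)

lemma l1Norm_nonneg (v : Fin m → ℝ) : 0 ≤ l1Norm v :=
  Finset.sum_nonneg fun _ _ => abs_nonneg _

lemma l1Norm_eq_zero {v : Fin m → ℝ} : l1Norm v = 0 ↔ v = 0 := by
  unfold l1Norm
  rw [Finset.sum_eq_zero_iff_of_nonneg fun _ _ => abs_nonneg _]
  simp [funext_iff]

lemma l1Norm_add {u v : Fin m → ℝ} (hu : 0 ≤ u) (hv : 0 ≤ v) :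
    l1Norm (u + v) = l1Norm u + l1Norm v := by
  rw [l1Norm_eq_sum (add_nonneg hu hv), l1Norm_eq_sum hu, l1Norm_eq_sum hv,
    ← Finset.sum_add_distrib]
  rfl

lemma l1Norm_smul {c : ℝ} (hc : 0 ≤ c) (v : Fin m → ℝ) : l1Norm (c • v) = c * l1Norm v := by
  simp [l1Norm, abs_mul, abs_of_nonneg hc, Finset.mul_sum]

lemma l1Norm_mono {u v : Fin m → ℝ} (hu : 0 ≤ u) (h : u ≤ v) : l1Norm u ≤ l1Norm v := by
  rw [l1Norm_eq_sum hu, l1Norm_eq_sum (hu.trans h)]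
  exact Finset.sum_le_sum fun i _ => h i

lemma l1Norm_single (i : Fin m) : l1Norm (Pi.single i (1 : ℝ)) = 1 := by
  rw [l1Norm_eq_sum (Pi.single_nonneg.2 zero_le_one)]
  simp

lemma l1Norm_sub {s v : Fin m → ℝ} (hs : 0 ≤ s) (h : s ≤ v) :
    l1Norm (v - s) = l1Norm v - l1Norm s := by
  have := l1Norm_add hs (sub_nonneg.2 h)
  rw [add_sub_cancel] at this
  linarith

lemma vecMul_nonneg {P : Matrix (Fin m) (Fin m) ℝ} (hP : ∀ i j, 0 ≤ P i j)
    {v : Fin m → ℝ} (hv : 0 ≤ v) : 0 ≤ v ᵥ* P := fun j =>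
  show 0 ≤ ∑ i, v i * P i j from Finset.sum_nonneg fun i _ => mul_nonneg (hv i) (hP i j)

lemma vecMul_mono {P : Matrix (Fin m) (Fin m) ℝ} (hP : ∀ i j, 0 ≤ P i j)
    {u v : Fin m → ℝ} (h : u ≤ v) : u ᵥ* P ≤ v ᵥ* P := fun j =>
  show ∑ i, u i * P i j ≤ ∑ i, v i * P i j from
    Finset.sum_le_sum fun i _ => mul_le_mul_of_nonneg_right (h i) (hP i j)

lemma vecMul_eq_sum (P : Matrix (Fin m) (Fin m) ℝ) (v : Fin m → ℝ) :
    v ᵥ* P = ∑ i, v i • (Pi.single i (1 : ℝ) ᵥ* P) := by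
  ext j
  simp [Matrix.vecMul, dotProduct, Finset.sum_apply]

variable {M : A → Matrix (Fin m) (Fin m) ℝ}

lemma wordMatrix_nil : wordMatrix M [] = 1 := rfl

lemma wordMatrix_append (w z : List A) :
    wordMatrix M (w ++ z) = wordMatrix M w * wordMatrix M z := by
  simp [wordMatrix]

lemma wordMatrix_singleton (a : A) : wordMatrix M [a] = M a := by
  simp [wordMatrix]

lemma vecMul_wordMatrix_append (v : Fin m → ℝ) (w z : List A) :
    v ᵥ* wordMatrix M (w ++ z) = v ᵥ* wordMatrix M w ᵥ* wordMatrix M z := by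
  rw [wordMatrix_append, Matrix.vecMul_vecMul]

lemma wordMatrix_nonneg (hM : ∀ a i j, 0 ≤ M a i j) (w : List A) (i j : Fin m) :
    0 ≤ wordMatrix M w i j := by
  induction w generalizing i with
  | nil => by_cases h : i = j <;> simp [wordMatrix_nil, h]
  | cons a w ih =>
    rw [← List.singleton_append, wordMatrix_append, wordMatrix_singleton, Matrix.mul_apply]
    exact Finset.sum_nonneg fun k _ => mul_nonneg (hM a i k) (ih k)

lemma l1Norm_vecMul_le_card [Fintype A] [Nonempty A]
    (hfair : IsSuperfair M) {v : Fin m → ℝ} (hv : 0 ≤ v) (a : A) :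
    l1Norm (v ᵥ* M a) ≤ Fintype.card A * l1Norm v := by
  have h := hfair v hv
  rw [div_le_iff₀ (by exact_mod_cast Fintype.card_pos), mul_comm] at h
  exact (Finset.single_le_sum (f := fun a => l1Norm (v ᵥ* M a))
    (fun _ _ => l1Norm_nonneg _) (Finset.mem_univ a)).trans h

/-! ### Non-betting vectors and the live part -/

lemma zero_mem_nonBetting : (0 : Fin m → ℝ) ∈ nonBetting M :=
  ⟨le_rfl, fun z => by simp⟩

lemma add_mem_nonBetting (hM : ∀ a i j, 0 ≤ M a i j) {s t : Fin m → ℝ}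
    (hs : s ∈ nonBetting M) (ht : t ∈ nonBetting M) : s + t ∈ nonBetting M := by
  refine ⟨add_nonneg hs.1 ht.1, fun z => ?_⟩
  have hz := wordMatrix_nonneg hM z
  rw [Matrix.add_vecMul, l1Norm_add (vecMul_nonneg hz hs.1) (vecMul_nonneg hz ht.1),
    l1Norm_add hs.1 ht.1, hs.2, ht.2]

lemma smul_mem_nonBetting {s : Fin m → ℝ} (hs : s ∈ nonBetting M) {c : ℝ} (hc : 0 ≤ c) :
    c • s ∈ nonBetting M := by
  refine ⟨smul_nonneg hc hs.1, fun z => ?_⟩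
  rw [Matrix.smul_vecMul, l1Norm_smul hc, l1Norm_smul hc, hs.2]

lemma vecMul_mem_nonBetting (hM : ∀ a i j, 0 ≤ M a i j) {s : Fin m → ℝ}
    (hs : s ∈ nonBetting M) (w : List A) : s ᵥ* wordMatrix M w ∈ nonBetting M := by
  refine ⟨vecMul_nonneg (wordMatrix_nonneg hM w) hs.1, fun z => ?_⟩
  rw [← vecMul_wordMatrix_append, hs.2, hs.2]

lemma live_le {s v : Fin m → ℝ} (hs : s ∈ nonBetting M) (h : s ≤ v) :
    live M v ≤ l1Norm v - l1Norm s := by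
  have hbdd : BddAbove (l1Norm '' {s | s ∈ nonBetting M ∧ s ≤ v}) := by
    refine ⟨l1Norm v, ?_⟩
    rintro _ ⟨t, ht, rfl⟩
    exact l1Norm_mono ht.1.1 ht.2
  exact sub_le_sub_left (le_csSup hbdd ⟨s, ⟨hs, h⟩, rfl⟩) _

/-- A bound that is valid for the remainder `v - s` of every non-betting `s ≤ v` is valid for the
live part, which is the infimum of the norms of these remainders. -/
lemma le_mul_live {v : Fin m → ℝ} (hv : 0 ≤ v) {b q : ℝ} (hq : 0 ≤ q)
    (h : ∀ s ∈ nonBetting M, s ≤ v → b ≤ q * (l1Norm v - l1Norm s)) : b ≤ q * live M v := by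
  refine le_of_forall_pos_le_add fun ε hε => ?_
  have hne : (l1Norm '' {s | s ∈ nonBetting M ∧ s ≤ v}).Nonempty :=
    ⟨_, 0, ⟨zero_mem_nonBetting, hv⟩, rfl⟩
  obtain ⟨_, ⟨s, hs, rfl⟩, hlt⟩ :=
    exists_lt_of_lt_csSup hne (sub_lt_self _ (div_pos hε (by linarith : 0 < q + 1)))
  have h1 := h s hs.1 hs.2
  have h2 : l1Norm v - l1Norm s ≤ live M v + ε / (q + 1) := by
    unfold live
    linarith
  have h3 : q * (ε / (q + 1)) ≤ ε := by
    rw [← mul_div_assoc, div_le_iff₀ (by linarith)]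
    nlinarith
  nlinarith [mul_le_mul_of_nonneg_left h2 hq]

lemma live_nonneg {v : Fin m → ℝ} (hv : 0 ≤ v) : 0 ≤ live M v := by
  have := le_mul_live (M := M) hv (b := 0) zero_le_one fun s hs h => by
    linarith [l1Norm_mono hs.1 h]
  linarith

lemma live_le_l1Norm {v : Fin m → ℝ} (hv : 0 ≤ v) : live M v ≤ l1Norm v :=
  (live_le zero_mem_nonBetting hv).trans (sub_le_self _ (l1Norm_nonneg _))

lemma live_eq_zero {s : Fin m → ℝ} (hs : s ∈ nonBetting M) : live M s = 0 :=
  le_antisymm ((live_le hs le_rfl).trans_eq (sub_self _)) (live_nonneg hs.1)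

lemma live_smul_le {v : Fin m → ℝ} (hv : 0 ≤ v) {c : ℝ} (hc : 0 ≤ c) :
    live M (c • v) ≤ c * live M v := by
  refine le_mul_live hv hc fun s hs h => ?_
  refine (live_le (smul_mem_nonBetting hs hc) (smul_le_smul_of_nonneg_left h hc)).trans_eq ?_
  rw [l1Norm_smul hc, l1Norm_smul hc, mul_sub]

lemma live_add_le (hM : ∀ a i j, 0 ≤ M a i j) {u v : Fin m → ℝ} (hu : 0 ≤ u) (hv : 0 ≤ v) :
    live M (u + v) ≤ live M u + live M v := by
  have h1 : live M (u + v) - live M v ≤ 1 * live M u :=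
    le_mul_live hu zero_le_one fun s hs hsu => by
      have h2 : live M (u + v) - (l1Norm u - l1Norm s) ≤ 1 * live M v :=
        le_mul_live hv zero_le_one fun t ht htv => by
          have := live_le (add_mem_nonBetting hM hs ht) (add_le_add hsu htv)
          rw [l1Norm_add hu hv, l1Norm_add hs.1 ht.1] at this
          linarith
      linarith
  linarith

lemma live_sum_le (hM : ∀ a i j, 0 ≤ M a i j) {ι : Type*} (t : Finset ι)
    (f : ι → Fin m → ℝ) (hf : ∀ i, 0 ≤ f i) :
    live M (∑ i ∈ t, f i) ≤ ∑ i ∈ t, live M (f i) := by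
  classical
  induction t using Finset.induction_on with
  | empty => simp [live_eq_zero zero_mem_nonBetting]
  | insert i t hi ih =>
    rw [Finset.sum_insert hi, Finset.sum_insert hi]
    have := live_add_le hM (hf i) (Finset.sum_nonneg fun j (_ : j ∈ t) => hf j)
    linarith

/-- The non-betting part `s` of `v` contributes nothing to the live part later on, so only the
remainder `v - s` counts, and its contribution splits over the basis vectors. -/
lemma live_vecMul_le (hM : ∀ a i j, 0 ≤ M a i j) {s v : Fin m → ℝ} (hs : s ∈ nonBetting M)
    (h : s ≤ v) (w : List A) :
    live M (v ᵥ* wordMatrix M w) ≤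
      ∑ i, (v - s) i * live M (Pi.single i (1 : ℝ) ᵥ* wordMatrix M w) := by
  have hw := wordMatrix_nonneg hM w
  have hr : 0 ≤ v - s := sub_nonneg.2 h
  have he : ∀ i, 0 ≤ Pi.single i (1 : ℝ) ᵥ* wordMatrix M w := fun i =>
    vecMul_nonneg hw (Pi.single_nonneg.2 zero_le_one)
  have h1 := live_add_le hM (vecMul_nonneg hw hs.1) (vecMul_nonneg hw hr)
  rw [← Matrix.add_vecMul, add_sub_cancel, live_eq_zero (vecMul_mem_nonBetting hM hs w),
    zero_add, vecMul_eq_sum _ (v - s)] at h1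
  refine h1.trans ((live_sum_le hM _ _ fun i => smul_nonneg (hr i) (he i)).trans ?_)
  exact Finset.sum_le_sum fun i _ => live_smul_le (he i) (hr i)

/-- The factor by which the word `w` can increase live parts, see `live_vecMul_le_mul`. -/
noncomputable def liveFactor (M : A → Matrix (Fin m) (Fin m) ℝ) (w : List A) : ℝ :=
  ∑ i, live M (Pi.single i (1 : ℝ) ᵥ* wordMatrix M w)

lemma live_single_vecMul_nonneg (hM : ∀ a i j, 0 ≤ M a i j) (w : List A) (i : Fin m) :
    0 ≤ live M (Pi.single i (1 : ℝ) ᵥ* wordMatrix M w) :=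
  live_nonneg (vecMul_nonneg (wordMatrix_nonneg hM w) (Pi.single_nonneg.2 zero_le_one))

lemma liveFactor_nonneg (hM : ∀ a i j, 0 ≤ M a i j) (w : List A) : 0 ≤ liveFactor M w :=
  Finset.sum_nonneg fun i _ => live_single_vecMul_nonneg hM w i

lemma live_vecMul_le_mul (hM : ∀ a i j, 0 ≤ M a i j) {v : Fin m → ℝ} (hv : 0 ≤ v)
    (w : List A) : live M (v ᵥ* wordMatrix M w) ≤ liveFactor M w * live M v := by
  refine le_mul_live hv (liveFactor_nonneg hM w) fun s hs h => ?_
  have hr : 0 ≤ v - s := sub_nonneg.2 h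
  rw [← l1Norm_sub hs.1 h, l1Norm_eq_sum hr, Finset.mul_sum]
  refine (live_vecMul_le hM hs h w).trans (Finset.sum_le_sum fun i _ => ?_)
  rw [mul_comm]
  refine mul_le_mul_of_nonneg_right ?_ (hr i)
  exact Finset.single_le_sum (f := fun i => live M (Pi.single i (1 : ℝ) ᵥ* wordMatrix M w))
    (fun i _ => live_single_vecMul_nonneg hM w i) (Finset.mem_univ i)

lemma live_vecMul_letter_le [Fintype A] [Nonempty A] (hM : ∀ a i j, 0 ≤ M a i j)
    (hfair : IsSuperfair M) {v : Fin m → ℝ} (hv : 0 ≤ v) (a : A) :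
    live M (v ᵥ* M a) ≤ Fintype.card A * live M v := by
  refine le_mul_live hv (Nat.cast_nonneg _) fun s hs h => ?_
  have hr : 0 ≤ v - s := sub_nonneg.2 h
  have h1 := live_le (vecMul_mem_nonBetting hM hs [a])
    (vecMul_mono (wordMatrix_nonneg hM [a]) h)
  have h2 := l1Norm_vecMul_le_card hfair hr a
  rw [wordMatrix_singleton] at h1
  rw [l1Norm_sub hs.1 h, Matrix.sub_vecMul,
    l1Norm_sub (vecMul_nonneg (hM a) hs.1) (vecMul_mono (hM a) h)] at h2
  exact h1.trans h2

/-- One letter changes the norm by at most a multiple of the live part: the norm of the non-betting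
part stays as it is. -/
lemma abs_l1Norm_vecMul_sub_le [Fintype A] [Nonempty A] (hM : ∀ a i j, 0 ≤ M a i j)
    (hfair : IsSuperfair M) {v : Fin m → ℝ} (hv : 0 ≤ v) (a : A) :
    |l1Norm (v ᵥ* M a) - l1Norm v| ≤ Fintype.card A * live M v := by
  refine le_mul_live hv (Nat.cast_nonneg _) fun s hs h => ?_
  have hr : 0 ≤ v - s := sub_nonneg.2 h
  have hcard : (1 : ℝ) ≤ Fintype.card A := by exact_mod_cast Fintype.card_pos
  have h1 := l1Norm_vecMul_le_card hfair hr a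
  have h2 := l1Norm_mono hs.1 h
  have h3 := l1Norm_mono (vecMul_nonneg (hM a) hs.1) (vecMul_mono (hM a) h)
  have h4 := hs.2 [a]
  rw [wordMatrix_singleton] at h4
  rw [l1Norm_sub hs.1 h, Matrix.sub_vecMul,
    l1Norm_sub (vecMul_nonneg (hM a) hs.1) (vecMul_mono (hM a) h)] at h1
  rw [abs_le]
  constructor <;> nlinarith

/-! ### Vectors that dominate a nonzero non-betting vector -/

/-- The vector `v` dominates some nonzero non-betting vector. -/
def HasNonBettingPart (M : A → Matrix (Fin m) (Fin m) ℝ) (v : Fin m → ℝ) : Prop :=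
  ∃ s ∈ nonBetting M, s ≠ 0 ∧ s ≤ v

lemma HasNonBettingPart.mono {u v : Fin m → ℝ} (h : HasNonBettingPart M u) (huv : u ≤ v) :
    HasNonBettingPart M v :=
  let ⟨s, hs, h0, hsu⟩ := h
  ⟨s, hs, h0, hsu.trans huv⟩

lemma HasNonBettingPart.vecMul (hM : ∀ a i j, 0 ≤ M a i j) {v : Fin m → ℝ}
    (h : HasNonBettingPart M v) (w : List A) : HasNonBettingPart M (v ᵥ* wordMatrix M w) := by
  obtain ⟨s, hs, h0, hsv⟩ := h
  refine ⟨_, vecMul_mem_nonBetting hM hs w, fun h => h0 ?_,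
    vecMul_mono (wordMatrix_nonneg hM w) hsv⟩
  rw [← l1Norm_eq_zero, ← hs.2 w, h, l1Norm_eq_zero]

lemma HasNonBettingPart.smul {v : Fin m → ℝ} (h : HasNonBettingPart M v) {c : ℝ}
    (hc : 0 < c) : HasNonBettingPart M (c • v) :=
  let ⟨s, hs, h0, hsv⟩ := h
  ⟨c • s, smul_mem_nonBetting hs hc.le, smul_ne_zero hc.ne' h0,
    smul_le_smul_of_nonneg_left hsv hc.le⟩

lemma HasNonBettingPart.live_lt {v : Fin m → ℝ} (h : HasNonBettingPart M v) :
    live M v < l1Norm v := by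
  obtain ⟨s, hs, h0, hsv⟩ := h
  have h1 := live_le hs hsv
  have h2 := (l1Norm_nonneg s).lt_of_ne' (mt l1Norm_eq_zero.1 h0)
  linarith

lemma exists_smul_le {s v : Fin m → ℝ} (hs : 0 ≤ s) (hv : 0 ≤ v)
    (h : ∀ i, 0 < s i → 0 < v i) : ∃ c > (0 : ℝ), c • s ≤ v := by
  have h1 : ∀ i, ∃ c > (0 : ℝ), c * s i ≤ v i := fun i => by
    rcases (hs i).eq_or_lt with h0 | h0
    · exact ⟨1, one_pos, by rw [← h0]; simpa using hv i⟩
    · exact ⟨v i / s i, div_pos (h i h0) h0, by rw [div_mul_cancel₀ _ h0.ne']⟩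
  choose c hc hcs using h1
  rcases isEmpty_or_nonempty (Fin m) with hm | hm
  · exact ⟨1, one_pos, fun i => hm.elim i⟩
  · obtain ⟨i₀, hi₀⟩ := Finite.exists_min c
    exact ⟨c i₀, hc i₀, fun i => (mul_le_mul_of_nonneg_right (hi₀ i) (hs i)).trans (hcs i)⟩

lemma single_smul_le {v : Fin m → ℝ} (hv : 0 ≤ v) (i : Fin m) :
    v i • Pi.single i (1 : ℝ) ≤ v := by
  intro j
  by_cases h : j = i
  · subst h; simp
  · simpa [h] using hv j

lemma HasNonBettingPart.vecMul_of_single (hM : ∀ a i j, 0 ≤ M a i j) {i : Fin m} {w : List A}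
    (h : HasNonBettingPart M (Pi.single i (1 : ℝ) ᵥ* wordMatrix M w)) {v : Fin m → ℝ}
    (hv : 0 ≤ v) (hi : 0 < v i) : HasNonBettingPart M (v ᵥ* wordMatrix M w) := by
  refine (h.smul hi).mono ?_
  rw [← Matrix.smul_vecMul]
  exact vecMul_mono (wordMatrix_nonneg hM w) (single_smul_le hv i)

/-- If a nonzero non-betting vector is supported on a set that is reachable from a singleton, then
every basis vector is taken by some word to a vector with a non-betting part. -/
lemma exists_word_hasNonBettingPart (hM : ∀ a i j, 0 ≤ M a i j) (hstar : StarCondition M)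
    {x : Fin m → ℝ} (hx : x ∈ nonBetting M) (hx0 : x ≠ 0)
    (hreach : supp x ∈ singletonReachable M) (i : Fin m) :
    ∃ w : List A, HasNonBettingPart M (Pi.single i (1 : ℝ) ᵥ* wordMatrix M w) := by
  obtain ⟨i₀, z, hz⟩ := hreach
  obtain ⟨y, hy⟩ := hstar i i₀
  have he : (0 : Fin m → ℝ) ≤ Pi.single i₀ (1 : ℝ) := Pi.single_nonneg.2 zero_le_one
  have h1 : HasNonBettingPart M (Pi.single i₀ (1 : ℝ) ᵥ* wordMatrix M z) := by
    obtain ⟨c, hc, hcx⟩ := exists_smul_le hx.1 (vecMul_nonneg (wordMatrix_nonneg hM z) he)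
      fun j hj => by
        have hj' : j ∈ supp x := by simpa [supp] using hj
        have hind : (fun k : Fin m => if k ∈ ({i₀} : Finset (Fin m)) then (1 : ℝ) else 0) =
            Pi.single i₀ 1 := by
          ext k
          simp [Pi.single_apply]
        rw [← hz, setAct, hind] at hj'
        simpa [supp] using hj'
    exact ⟨c • x, smul_mem_nonBetting hx hc.le, smul_ne_zero hc.ne' hx0, hcx⟩
  refine ⟨y ++ z, ?_⟩
  rw [vecMul_wordMatrix_append]
  refine h1.vecMul_of_single hM (vecMul_nonneg (wordMatrix_nonneg hM y)
    (Pi.single_nonneg.2 zero_le_one)) ?_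
  simpa using hy

/-- A single word that takes every basis vector either to `0` or to a vector with a non-betting
part. It is built by treating the indices one after the other: what has been achieved for the
earlier ones is preserved by longer words. -/
lemma exists_word_forall (hM : ∀ a i j, 0 ≤ M a i j)
    (h : ∀ i : Fin m, ∃ w : List A, HasNonBettingPart M (Pi.single i (1 : ℝ) ᵥ* wordMatrix M w)) :
    ∃ w : List A, ∀ i : Fin m, Pi.single i (1 : ℝ) ᵥ* wordMatrix M w = 0 ∨
      HasNonBettingPart M (Pi.single i (1 : ℝ) ᵥ* wordMatrix M w) := by
  suffices H : ∀ t : Finset (Fin m), ∃ w : List A, ∀ i ∈ t,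
      Pi.single i (1 : ℝ) ᵥ* wordMatrix M w = 0 ∨
        HasNonBettingPart M (Pi.single i (1 : ℝ) ᵥ* wordMatrix M w) by
    obtain ⟨w, hw⟩ := H Finset.univ
    exact ⟨w, fun i => hw i (Finset.mem_univ i)⟩
  intro t
  induction t using Finset.induction_on with
  | empty => exact ⟨[], by simp⟩
  | insert i t _ ih =>
    obtain ⟨w, hw⟩ := ih
    have hpos : 0 ≤ Pi.single i (1 : ℝ) ᵥ* wordMatrix M w :=
      vecMul_nonneg (wordMatrix_nonneg hM w) (Pi.single_nonneg.2 zero_le_one)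
    obtain ⟨z, hz⟩ : ∃ z : List A, Pi.single i (1 : ℝ) ᵥ* wordMatrix M (w ++ z) = 0 ∨
        HasNonBettingPart M (Pi.single i (1 : ℝ) ᵥ* wordMatrix M (w ++ z)) := by
      by_cases h0 : Pi.single i (1 : ℝ) ᵥ* wordMatrix M w = 0
      · exact ⟨[], by simp [h0]⟩
      · obtain ⟨j, hj⟩ := Function.ne_iff.1 h0
        obtain ⟨z, hz⟩ := h j
        refine ⟨z, Or.inr ?_⟩
        rw [vecMul_wordMatrix_append]
        exact hz.vecMul_of_single hM hpos ((hpos j).lt_of_ne' hj)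
    refine ⟨w ++ z, fun j hj => ?_⟩
    rcases Finset.mem_insert.1 hj with rfl | hj
    · exact hz
    · rw [vecMul_wordMatrix_append]
      rcases hw j hj with h0 | h0
      · simp [h0]
      · exact Or.inr (h0.vecMul hM z)

/-! ### Exponential decay of real sequences -/

/-- A nonnegative sequence whose increments over `k` steps are controlled by factors `c n` decays
exponentially fast if the Cesàro means of `log (c n)` have a negative limit. The products of `k`
consecutive terms change by the factor `c n` in each single step, so the factors need not be
restricted to a residue class modulo `k`. -/
lemma expConvergesTo_zero_of_le_mul {L c : ℕ → ℝ} (hL : ∀ n, 0 ≤ L n) (hc : ∀ n, 0 < c n)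
    {k : ℕ} (hk : 0 < k) {K : ℝ} (hK : 1 ≤ K) (hLK : ∀ n, L (n + 1) ≤ K * L n)
    (hLc : ∀ n, L (n + k) ≤ c n * L n) {β : ℝ} (hβ : β < 0)
    (hlim : Tendsto (fun n : ℕ => (∑ j ∈ Finset.range n, Real.log (c j)) / (n : ℝ)) atTop (𝓝 β)) :
    ExpConvergesTo L 0 := by
  have hK0 : 0 ≤ K := zero_le_one.trans hK
  set P : ℕ → ℝ := fun n => ∏ t ∈ Finset.range k, L (n + t) with hP
  have hP0 : ∀ n, 0 ≤ P n := fun n => Finset.prod_nonneg fun t _ => hL _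
  have hPstep : ∀ n, P (n + 1) ≤ c n * P n := fun n => by
    obtain ⟨k', rfl⟩ := Nat.exists_eq_succ_of_ne_zero hk.ne'
    have hQ : 0 ≤ ∏ t ∈ Finset.range k', L (n + (t + 1)) := Finset.prod_nonneg fun t _ => hL _
    simp only [hP]
    rw [Finset.prod_range_succ, Finset.prod_range_succ' (fun t => L (n + t)),
      Finset.prod_congr rfl fun t _ => by rw [show n + 1 + t = n + (t + 1) by ring]]
    have := mul_le_mul_of_nonneg_left (hLc n) hQ
    rw [show n + 1 + k' = n + k'.succ by rw [Nat.succ_eq_add_one]; ring, add_zero]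
    linarith
  have hPexp : ∀ n, P n ≤ P 0 * Real.exp (∑ j ∈ Finset.range n, Real.log (c j)) := fun n => by
    induction n with
    | zero => simp
    | succ n ih =>
      rw [Finset.sum_range_succ, Real.exp_add, Real.exp_log (hc n)]
      have := mul_le_mul_of_nonneg_left ih (hc n).le
      linarith [hPstep n]
  have hLpow : ∀ t n, L (n + t) ≤ K ^ t * L n := fun t n => by
    induction t with
    | zero => simp
    | succ t ih =>
      rw [pow_succ']
      have := mul_le_mul_of_nonneg_left ih hK0
      rw [← add_assoc]
      linarith [hLK (n + t)]
  have hLP : ∀ n, L (n + k) ^ k ≤ (K ^ k) ^ k * P n := fun n => by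
    have : ∏ t ∈ Finset.range k, L (n + k) ≤ ∏ t ∈ Finset.range k, (K ^ k * L (n + t)) := by
      refine Finset.prod_le_prod (fun t _ => hL _) fun t ht => ?_
      have htk : t ≤ k := (Finset.mem_range.1 ht).le
      have h1 := hLpow (k - t) (n + t)
      rw [add_assoc, Nat.add_sub_cancel' htk] at h1
      exact h1.trans (mul_le_mul_of_nonneg_right
        (pow_le_pow_right₀ hK (Nat.sub_le k t)) (hL _))
    simpa [Finset.prod_mul_distrib] using this
  set α : ℝ := -β / (2 * k) with hα
  have hkR : (0 : ℝ) < k := by exact_mod_cast hk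
  have hα0 : 0 < α := div_pos (neg_pos.2 hβ) (by positivity)
  set D : ℝ := max 1 ((K ^ k) ^ k * P 0) with hD
  have hD1 : 1 ≤ D := le_max_left _ _
  have hev : ∀ᶠ n : ℕ in atTop, L (n + k) ≤ D * Real.exp (-α * n) := by
    have h1 := hlim.eventually_lt_const (show β < β / 2 by linarith)
    filter_upwards [h1, eventually_gt_atTop 0] with n hn hn0
    have hnR : (0 : ℝ) < n := by exact_mod_cast hn0
    rw [div_lt_iff₀ hnR] at hn
    refine le_of_pow_le_pow_left₀ hk.ne' (by positivity) ?_
    have h2 : Real.exp (-α * n) ^ k = Real.exp (β / 2 * n) := by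
      rw [← Real.exp_nat_mul]
      congr 1
      rw [hα]
      field_simp
    rw [mul_pow, h2]
    calc L (n + k) ^ k
        ≤ (K ^ k) ^ k * (P 0 * Real.exp (∑ j ∈ Finset.range n, Real.log (c j))) :=
          (hLP n).trans (mul_le_mul_of_nonneg_left (hPexp n) (by positivity))
      _ = (K ^ k) ^ k * P 0 * Real.exp (∑ j ∈ Finset.range n, Real.log (c j)) := by ring
      _ ≤ D ^ k * Real.exp (β / 2 * n) :=
          mul_le_mul ((le_max_right _ _).trans (le_self_pow₀ hD1 hk.ne'))
            (Real.exp_le_exp.2 hn.le) (Real.exp_pos _).le (by positivity)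
  refine ⟨α, hα0, IsBigO.of_bound (D * Real.exp (α * k)) ?_⟩
  filter_upwards [(tendsto_sub_atTop_nat k).eventually hev, eventually_ge_atTop k] with n hn hkn
  rw [Nat.sub_add_cancel hkn, Nat.cast_sub hkn] at hn
  rw [sub_zero, Real.norm_of_nonneg (hL n), Real.norm_of_nonneg (Real.exp_pos _).le, mul_assoc,
    ← Real.exp_add]
  rwa [show α * k + -α * n = -α * (n - k) by ring]

lemma exists_expConvergesTo_of_abs_sub_le {u L : ℕ → ℝ} {K : ℝ} (hK : 0 ≤ K)
    (hu : ∀ n, |u (n + 1) - u n| ≤ K * L n) (hL : ExpConvergesTo L 0) :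
    ∃ l, Tendsto u atTop (𝓝 l) ∧ ExpConvergesTo u l := by
  obtain ⟨α, hα, h⟩ := hL
  obtain ⟨C, hC, hb⟩ := bound_of_isBigO_nat_atTop h
  set r := Real.exp (-α) with hr
  have hr1 : r < 1 := by simpa [hr] using hα
  have hrn : ∀ n : ℕ, Real.exp (-α * n) = r ^ n := fun n => by
    rw [hr, ← Real.exp_nat_mul, mul_comm]
  have hd : ∀ n, dist (u n) (u (n + 1)) ≤ K * C * r ^ n := fun n => by
    have h1 := hb (x := n) (Real.exp_ne_zero _)
    rw [sub_zero, Real.norm_of_nonneg (Real.exp_pos _).le, hrn] at h1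
    rw [dist_comm, Real.dist_eq, mul_assoc]
    exact (hu n).trans (mul_le_mul_of_nonneg_left ((le_abs_self _).trans h1) hK)
  obtain ⟨l, hl⟩ := cauchySeq_tendsto_of_complete (cauchySeq_of_le_geometric r _ hr1 hd)
  refine ⟨l, hl, α, hα, IsBigO.of_bound (K * C / (1 - r)) (Eventually.of_forall fun n => ?_)⟩
  rw [Real.norm_of_nonneg (Real.exp_pos _).le, hrn, ← dist_eq_norm]
  refine (dist_le_of_le_geometric_of_tendsto r _ hr1 hd hl n).trans_eq ?_
  ring

/-! ### Block frequencies in normal sequences -/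

/-- In a normal sequence, the mean of a function of the blocks of length `k`, taken at all
positions, tends to its mean over all words of length `k`. -/
lemma IsNormal.tendsto_mean [Fintype A] {X : ℕ → A} (hX : IsNormal X) (k : ℕ) (f : List A → ℝ) :
    Tendsto (fun n : ℕ =>
        (∑ j ∈ Finset.range n, f (List.ofFn fun t : Fin k => X (j + t))) / (n : ℝ)) atTop
      (𝓝 ((∑ u : Fin k → A, f (List.ofFn u)) / (Fintype.card A : ℝ) ^ k)) := by
  classical
  have h : Tendsto (fun n : ℕ => ∑ u : Fin k → A, (((Finset.range n).filter
      fun j => (fun t : Fin k => X (j + t)) = u).card : ℝ) / n * f (List.ofFn u)) atTop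
      (𝓝 (∑ u : Fin k → A, ((Fintype.card A : ℝ) ^ k)⁻¹ * f (List.ofFn u))) := by
    refine tendsto_finsetSum _ fun u _ => Tendsto.mul_const _ ?_
    have := hX (List.ofFn u)
    simp only [List.length_ofFn, List.getElem_ofFn] at this
    refine this.congr fun n => ?_
    congr 3
    ext j
    simp [funext_iff, Fin.forall_iff]
  rw [← Finset.mul_sum, inv_mul_eq_div] at h
  refine h.congr fun n => ?_
  rw [← Finset.sum_fiberwise (Finset.range n) (fun j => fun t : Fin k => X (j + t)),
    Finset.sum_div]
  refine Finset.sum_congr rfl fun u _ => ?_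
  rw [Finset.sum_congr rfl fun j hj => by rw [(Finset.mem_filter.1 hj).2], Finset.sum_const,
    nsmul_eq_mul, div_mul_eq_mul_div]

lemma IsNormal.exists_occurrence [Fintype A] [Nonempty A] {X : ℕ → A} (hX : IsNormal X)
    (w : List A) : ∃ i, List.ofFn (fun t : Fin w.length => X (i + t)) = w := by
  classical
  by_contra! hne
  have h := hX w
  have h0 : ∀ n : ℕ, ((Finset.range n).filter
      (fun i => ∀ (j : ℕ) (hj : j < w.length), X (i + j) = w[j])) = ∅ := fun n => by
    refine Finset.filter_eq_empty_iff.2 fun i _ hi => hne i ?_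
    refine List.ext_getElem (by simp) fun j _ hj => ?_
    simpa using hi j hj
  have h1 : Tendsto (fun _ : ℕ => (0 : ℝ)) atTop (𝓝 (((Fintype.card A : ℝ) ^ w.length)⁻¹)) := by
    refine h.congr fun n => ?_
    have := h0 n
    convert zero_div (n : ℝ)
    rw [Nat.cast_eq_zero, Finset.card_eq_zero]
    convert this
  have h2 := tendsto_nhds_unique h1 tendsto_const_nhds
  have : (0 : ℝ) < Fintype.card A := by exact_mod_cast Fintype.card_pos
  have : 0 < ((Fintype.card A : ℝ) ^ w.length)⁻¹ := by positivity
  linarith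

lemma seqPrefix_add (X : ℕ → A) (n k : ℕ) :
    seqPrefix X (n + k) = seqPrefix X n ++ List.ofFn fun t : Fin k => X (n + t) := by
  refine List.ext_getElem (by simp [seqPrefix]) fun j h1 h2 => ?_
  rcases lt_or_ge j n with h | h
  · rw [List.getElem_append_left (by simpa [seqPrefix] using h)]
    simp [seqPrefix]
  · rw [List.getElem_append_right (by simpa [seqPrefix] using h)]
    simp [seqPrefix, h]

lemma orbit_add (v : Fin m → ℝ) (X : ℕ → A) (n k : ℕ) :
    orbit M v X (n + k) =
      orbit M v X n ᵥ* wordMatrix M (List.ofFn fun t : Fin k => X (n + t)) := by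
  rw [orbit, seqPrefix_add, vecMul_wordMatrix_append, orbit]

lemma orbit_succ (v : Fin m → ℝ) (X : ℕ → A) (n : ℕ) :
    orbit M v X (n + 1) = orbit M v X n ᵥ* M (X n) := by
  rw [orbit_add]
  simp [wordMatrix_singleton]

lemma orbit_nonneg (hM : ∀ a i j, 0 ≤ M a i j) {v : Fin m → ℝ} (hv : 0 ≤ v) (X : ℕ → A) (n : ℕ) :
    0 ≤ orbit M v X n :=
  vecMul_nonneg (wordMatrix_nonneg hM _) hv

/-! ### Means over the words of a given length -/

/-- The mean of `g (v M_a)` over the letters `a`. Its iterates are the means over the words of a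
given length, see `iterate_letterMean`. -/
noncomputable def letterMean [Fintype A] (M : A → Matrix (Fin m) (Fin m) ℝ)
    (g : (Fin m → ℝ) → ℝ) (v : Fin m → ℝ) : ℝ :=
  (∑ a, g (v ᵥ* M a)) / (Fintype.card A : ℝ)

lemma iterate_letterMean [Fintype A] (k : ℕ) (g : (Fin m → ℝ) → ℝ) (v : Fin m → ℝ) :
    (letterMean M)^[k] g v =
      (∑ u : Fin k → A, g (v ᵥ* wordMatrix M (List.ofFn u))) / (Fintype.card A : ℝ) ^ k := by
  induction k generalizing v with
  | zero => simp [wordMatrix_nil]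
  | succ k ih =>
    rw [Function.iterate_succ_apply', letterMean,
      ← Fintype.sum_equiv (Fin.consEquiv fun _ : Fin (k + 1) => A)
        (fun p : A × (Fin k → A) => g (v ᵥ* M p.1 ᵥ* wordMatrix M (List.ofFn p.2))),
      Fintype.sum_prod_type]
    · simp_rw [ih]
      rw [← Finset.sum_div, div_div, pow_succ]
    · rintro ⟨a, u⟩
      change _ = g (v ᵥ* wordMatrix M (List.ofFn (Fin.cons a u : Fin (k + 1) → A)))
      rw [List.ofFn_cons, ← List.singleton_append, vecMul_wordMatrix_append, wordMatrix_singleton]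

/-- A contraction rate for the mean over the words of length `k` can be iterated, since the cone
of nonnegative vectors is invariant. -/
lemma iterate_letterMean_mul_le [Fintype A] (hM : ∀ a i j, 0 ≤ M a i j) {k : ℕ}
    {g : (Fin m → ℝ) → ℝ} {q : ℝ} (hq : 0 ≤ q)
    (h : ∀ v, 0 ≤ v → (letterMean M)^[k] g v ≤ q * g v) (j : ℕ) {v : Fin m → ℝ} (hv : 0 ≤ v) :
    (letterMean M)^[k * j] g v ≤ q ^ j * g v := by
  induction j generalizing v with
  | zero => simp
  | succ j ih =>
    rw [mul_add_one, add_comm, Function.iterate_add_apply, iterate_letterMean]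
    have h1 : (∑ u : Fin k → A, (letterMean M)^[k * j] g (v ᵥ* wordMatrix M (List.ofFn u))) /
        (Fintype.card A : ℝ) ^ k ≤
        (∑ u : Fin k → A, q ^ j * g (v ᵥ* wordMatrix M (List.ofFn u))) /
          (Fintype.card A : ℝ) ^ k := by
      gcongr with u
      exact ih (vecMul_nonneg (wordMatrix_nonneg hM _) hv)
    refine h1.trans ?_
    rw [← Finset.mul_sum, mul_div_assoc, ← iterate_letterMean, pow_succ, mul_assoc]
    exact mul_le_mul_of_nonneg_left (h v hv) (pow_nonneg hq j)

lemma iterate_letterMean_l1Norm_le [Fintype A] (hM : ∀ a i j, 0 ≤ M a i j)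
    (hfair : IsSuperfair M) (k : ℕ) {v : Fin m → ℝ} (hv : 0 ≤ v) :
    (letterMean M)^[k] l1Norm v ≤ l1Norm v := by
  have := iterate_letterMean_mul_le hM (k := 1) (g := l1Norm) zero_le_one
    (fun v hv => (hfair v hv).trans_eq (one_mul _).symm) k hv
  simpa using this

/-- If every basis vector can reach a vector with a non-betting part, then the live part contracts
on average over the words of some length. Words are padded to a common length, and linearity
reduces the claim to the basis vectors. -/
lemma exists_iterate_letterMean_live_le [Fintype A] [Nonempty A] [Nonempty (Fin m)]
    (hM : ∀ a i j, 0 ≤ M a i j) (hfair : IsSuperfair M)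
    (h : ∀ i : Fin m, ∃ w : List A, HasNonBettingPart M (Pi.single i (1 : ℝ) ᵥ* wordMatrix M w)) :
    ∃ N > 0, ∃ q : ℝ, 0 ≤ q ∧ q < 1 ∧
      ∀ v, 0 ≤ v → (letterMean M)^[N] (live M) v ≤ q * live M v := by
  choose w hw using h
  have he : ∀ i, (0 : Fin m → ℝ) ≤ Pi.single i (1 : ℝ) := fun i => Pi.single_nonneg.2 zero_le_one
  have hcard : (0 : ℝ) < Fintype.card A := by exact_mod_cast Fintype.card_pos
  obtain ⟨N, hN⟩ : ∃ N, N = ∑ i, (w i).length + 1 := ⟨_, rfl⟩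
  have hlt : ∀ i, (letterMean M)^[N] (live M) (Pi.single i 1) < 1 := fun i => by
    obtain ⟨a⟩ := ‹Nonempty A›
    have hlen : (w i).length ≤ N := (Finset.single_le_sum (f := fun i => (w i).length)
      (fun _ _ => Nat.zero_le _) (Finset.mem_univ i)).trans (hN ▸ Nat.le_succ _)
    -- `w i` padded to length `N`; the non-betting part survives the padding
    set z := w i ++ List.replicate (N - (w i).length) a with hz
    have hzN : z.length = N := by simp [hz, hlen]
    have hzw : List.ofFn (fun t : Fin N => z[t]) = z := by
      refine List.ext_getElem (by simp [hzN]) fun j _ _ => by simp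
    refine lt_of_lt_of_le ?_ ((iterate_letterMean_l1Norm_le hM hfair N (he i)).trans_eq
      (l1Norm_single i))
    rw [iterate_letterMean, iterate_letterMean]
    refine div_lt_div_of_pos_right (Finset.sum_lt_sum (fun u _ => live_le_l1Norm
      (vecMul_nonneg (wordMatrix_nonneg hM _) (he i)))
      ⟨fun t => z[t], Finset.mem_univ _, ?_⟩) (by positivity)
    rw [hzw, hz, vecMul_wordMatrix_append]
    exact ((hw i).vecMul hM _).live_lt
  obtain ⟨i₀, hi₀⟩ := Finite.exists_max fun i => (letterMean M)^[N] (live M) (Pi.single i 1)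
  have hq0 : 0 ≤ (letterMean M)^[N] (live M) (Pi.single i₀ 1) := by
    rw [iterate_letterMean]
    exact div_nonneg (Finset.sum_nonneg fun u _ => live_single_vecMul_nonneg hM _ _) (by positivity)
  refine ⟨N, hN ▸ Nat.succ_pos _, _, hq0, hlt i₀, fun v hv => le_mul_live hv hq0 fun s hs hsv => ?_⟩
  have hr : 0 ≤ v - s := sub_nonneg.2 hsv
  rw [← l1Norm_sub hs.1 hsv, l1Norm_eq_sum hr, Finset.mul_sum]
  calc (letterMean M)^[N] (live M) v
      ≤ (∑ u : Fin N → A, ∑ i, (v - s) i *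
          live M (Pi.single i (1 : ℝ) ᵥ* wordMatrix M (List.ofFn u))) /
            (Fintype.card A : ℝ) ^ N := by
        rw [iterate_letterMean]
        gcongr with u
        exact live_vecMul_le hM hs hsv _
    _ = ∑ i, (v - s) i * (letterMean M)^[N] (live M) (Pi.single i 1) := by
        rw [Finset.sum_comm, Finset.sum_div]
        refine Finset.sum_congr rfl fun i _ => ?_
        rw [iterate_letterMean, ← Finset.mul_sum, mul_div_assoc]
    _ ≤ _ := Finset.sum_le_sum fun i _ => by
        rw [mul_comm]
        exact mul_le_mul_of_nonneg_right (hi₀ i) (hr i)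

/-- For words of some length, the logarithm of (a positive bound for) the growth factor of the live
part has a negative mean: the mean of the factors themselves becomes small, and
`log t ≤ t - 1`. -/
lemma exists_sum_log_neg [Fintype A] [Nonempty A] [Nonempty (Fin m)]
    (hM : ∀ a i j, 0 ≤ M a i j) (hfair : IsSuperfair M)
    (h : ∀ i : Fin m, ∃ w : List A, HasNonBettingPart M (Pi.single i (1 : ℝ) ᵥ* wordMatrix M w)) :
    ∃ k > 0, ∃ c : List A → ℝ, (∀ w, 0 < c w) ∧ (∀ w, liveFactor M w ≤ c w) ∧
      (∑ u : Fin k → A, Real.log (c (List.ofFn u))) / (Fintype.card A : ℝ) ^ k < 0 := by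
  obtain ⟨N, hN, q, hq0, hq1, hq⟩ := exists_iterate_letterMean_live_le hM hfair h
  have hcard : (0 : ℝ) < Fintype.card A := by exact_mod_cast Fintype.card_pos
  have hm : (0 : ℝ) < m := by
    have : 0 < Fintype.card (Fin m) := Fintype.card_pos
    rw [Fintype.card_fin] at this
    exact_mod_cast this
  obtain ⟨j, hj⟩ := exists_pow_lt_of_lt_one (show 0 < 1 / (2 * (m : ℝ)) by positivity) hq1
  have hmean : (∑ u : Fin (N * (j + 1)) → A, liveFactor M (List.ofFn u)) /
      (Fintype.card A : ℝ) ^ (N * (j + 1)) ≤ 1 / 2 := by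
    have h1 : ∀ i : Fin m, (letterMean M)^[N * (j + 1)] (live M) (Pi.single i 1) ≤
        1 / (2 * m) := fun i => by
      have he : (0 : Fin m → ℝ) ≤ Pi.single i (1 : ℝ) := Pi.single_nonneg.2 zero_le_one
      refine (iterate_letterMean_mul_le hM hq0 hq (j + 1) he).trans ?_
      have h2 : live M (Pi.single i (1 : ℝ)) ≤ 1 :=
        (live_le_l1Norm he).trans_eq (l1Norm_single i)
      have h3 : q ^ (j + 1) ≤ q ^ j := pow_le_pow_of_le_one hq0 hq1.le (Nat.le_succ j)
      nlinarith [pow_nonneg hq0 (j + 1), live_nonneg (M := M) he]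
    simp only [liveFactor]
    rw [Finset.sum_comm, Finset.sum_div]
    simp_rw [← iterate_letterMean]
    refine (Finset.sum_le_sum fun i _ => h1 i).trans_eq ?_
    rw [Finset.sum_const, Finset.card_univ, Fintype.card_fin, nsmul_eq_mul]
    field_simp
  -- A factor may be `0`; the summand `1 / 4` makes it positive and leaves the mean below `1`.
  refine ⟨N * (j + 1), by positivity, fun w => liveFactor M w + 1 / 4,
    fun w => by linarith [liveFactor_nonneg hM w], fun w => by linarith, ?_⟩
  set k := N * (j + 1)
  have hck : (0 : ℝ) < (Fintype.card A : ℝ) ^ k := by positivity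
  calc (∑ u : Fin k → A, Real.log (liveFactor M (List.ofFn u) + 1 / 4)) / (Fintype.card A : ℝ) ^ k
      ≤ (∑ u : Fin k → A, (liveFactor M (List.ofFn u) - 3 / 4)) / (Fintype.card A : ℝ) ^ k := by
        gcongr with u
        have := Real.log_le_sub_one_of_pos
          (show 0 < liveFactor M (List.ofFn u) + 1 / 4 by
            linarith [liveFactor_nonneg hM (List.ofFn u)])
        linarith
    _ = (∑ u : Fin k → A, liveFactor M (List.ofFn u)) / (Fintype.card A : ℝ) ^ k - 3 / 4 := by
        rw [Finset.sum_sub_distrib, sub_div, Finset.sum_const, Finset.card_univ,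
          Fintype.card_fun, Fintype.card_fin, nsmul_eq_mul, Nat.cast_pow,
          mul_div_cancel_left₀ _ hck.ne']
    _ < 0 := by linarith

/-! ### Vectors without risk are non-betting -/

/-- A unit vector without risk keeps its norm under every letter: by superfairness the mean of
`p a - 1 - log (p a) ≥ 0`, where `p a = ‖u M_a‖`, is at most `0`, and `log t = t - 1` only at
`t = 1`. -/
lemma l1Norm_vecMul_eq_one_of_risk [Fintype A] [Nonempty A] (hfair : IsSuperfair M)
    {u : Fin m → ℝ} (hu : 0 ≤ u) (h1 : l1Norm u = 1) (h : risk M u = 0) (a : A) :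
    l1Norm (u ᵥ* M a) = 1 := by
  have hcard : (0 : ℝ) < Fintype.card A := by exact_mod_cast Fintype.card_pos
  unfold risk at h
  split_ifs at h with h0
  · exact absurd h one_ne_zero
  · push Not at h0
    have hpos : ∀ b, 0 < l1Norm (u ᵥ* M b) := fun b => (l1Norm_nonneg _).lt_of_ne' (h0 b)
    have hlog : ∑ b, Real.log (l1Norm (u ᵥ* M b)) = 0 := by
      rw [h1, Real.log_one, zero_sub] at h
      have h2 : (∑ b, Real.log (l1Norm (u ᵥ* M b))) / (Fintype.card A : ℝ) = 0 := by
        rcases min_choice (1 : ℝ)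
          (-((∑ b, Real.log (l1Norm (u ᵥ* M b))) / (Fintype.card A : ℝ))) with h3 | h3
        · rw [h3] at h
          exact absurd h one_ne_zero
        · rw [h3] at h
          linarith
      exact (div_eq_zero_iff.1 h2).resolve_right hcard.ne'
    have hsum : ∑ b, l1Norm (u ᵥ* M b) ≤ Fintype.card A := by
      have := hfair u hu
      rwa [h1, div_le_one hcard] at this
    have hterm : ∀ b ∈ Finset.univ,
        0 ≤ l1Norm (u ᵥ* M b) - 1 - Real.log (l1Norm (u ᵥ* M b)) := fun b _ => by
      linarith [Real.log_le_sub_one_of_pos (hpos b)]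
    have hzero : ∑ b, (l1Norm (u ᵥ* M b) - 1 - Real.log (l1Norm (u ᵥ* M b))) = 0 := by
      refine le_antisymm ?_ (Finset.sum_nonneg hterm)
      rw [Finset.sum_sub_distrib, Finset.sum_sub_distrib, hlog, Finset.sum_const,
        Finset.card_univ, nsmul_eq_mul]
      linarith
    have ha := (Finset.sum_eq_zero_iff_of_nonneg hterm).1 hzero a (Finset.mem_univ a)
    by_contra hne
    linarith [Real.log_lt_sub_one_of_pos (hpos a) hne]

lemma mem_nonBetting_of_risk [Fintype A] [Nonempty A] (hM : ∀ a i j, 0 ≤ M a i j)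
    (hfair : IsSuperfair M) {x : Fin m → ℝ} (hx : 0 ≤ x) (h1 : l1Norm x = 1)
    (hrisk : ∀ z : List A, risk M (act M x z) = 0) : x ∈ nonBetting M := by
  refine ⟨hx, fun z => ?_⟩
  rw [h1]
  induction z using List.reverseRecOn with
  | nil => simpa [wordMatrix_nil] using h1
  | append_singleton z a ih =>
    have hne : x ᵥ* wordMatrix M z ≠ 0 := fun h0 => by
      rw [l1Norm_eq_zero.2 h0] at ih
      exact zero_ne_one ih
    have hr := hrisk z
    rw [act, if_neg hne, ih, inv_one, one_smul] at hr
    rw [vecMul_wordMatrix_append, wordMatrix_singleton]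
    exact l1Norm_vecMul_eq_one_of_risk hfair
      (vecMul_nonneg (wordMatrix_nonneg hM z) hx) ih hr a

/-! ### Orbits along normal sequences -/

lemma expConvergesTo_live_orbit [Fintype A] [Nonempty A] [Nonempty (Fin m)]
    (hM : ∀ a i j, 0 ≤ M a i j) (hfair : IsSuperfair M)
    (h : ∀ i : Fin m, ∃ w : List A, HasNonBettingPart M (Pi.single i (1 : ℝ) ᵥ* wordMatrix M w))
    {X : ℕ → A} (hX : IsNormal X) {v : Fin m → ℝ} (hv : 0 ≤ v) :
    ExpConvergesTo (fun n => live M (orbit M v X n)) 0 := by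
  obtain ⟨k, hk, c, hc0, hc, hneg⟩ := exists_sum_log_neg hM hfair h
  refine expConvergesTo_zero_of_le_mul (c := fun n => c (List.ofFn fun t : Fin k => X (n + t)))
    (fun n => live_nonneg (orbit_nonneg hM hv X n)) (fun n => hc0 _) hk
    (K := Fintype.card A) (by exact_mod_cast Fintype.card_pos) (fun n => ?_) (fun n => ?_) hneg
    (hX.tendsto_mean k fun w => Real.log (c w))
  · rw [orbit_succ]
    exact live_vecMul_letter_le hM hfair (orbit_nonneg hM hv X n) _
  · rw [orbit_add]
    exact (live_vecMul_le_mul hM (orbit_nonneg hM hv X n) _).trans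
      (mul_le_mul_of_nonneg_right (hc _) (live_nonneg (orbit_nonneg hM hv X n)))

/-- Along a sequence in which every word occurs, an orbit dies or acquires a non-betting part. -/
lemma orbit_eq_zero_or_hasNonBettingPart [Fintype A] [Nonempty A]
    (hM : ∀ a i j, 0 ≤ M a i j)
    (h : ∀ i : Fin m, ∃ w : List A, HasNonBettingPart M (Pi.single i (1 : ℝ) ᵥ* wordMatrix M w))
    {X : ℕ → A} (hX : IsNormal X) {v : Fin m → ℝ} (hv : 0 ≤ v) :
    ∃ n, orbit M v X n = 0 ∨ HasNonBettingPart M (orbit M v X n) := by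
  obtain ⟨w, hw⟩ := exists_word_forall hM h
  obtain ⟨n, hn⟩ := hX.exists_occurrence w
  refine ⟨n + w.length, ?_⟩
  rw [orbit_add, hn]
  have hpos := orbit_nonneg hM hv X n
  by_cases hall : ∀ i, orbit M v X n i = 0 ∨ Pi.single i (1 : ℝ) ᵥ* wordMatrix M w = 0
  · left
    rw [vecMul_eq_sum]
    refine Finset.sum_eq_zero fun i _ => ?_
    rcases hall i with h0 | h0 <;> simp [h0]
  · right
    push Not at hall
    obtain ⟨i, hi, hne⟩ := hall
    exact ((hw i).resolve_left hne).vecMul_of_single hM hpos ((hpos i).lt_of_ne' hi)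

lemma orbit_eventually_zero_or_expConvergesTo [Fintype A] [Nonempty A] [Nonempty (Fin m)]
    (hM : ∀ a i j, 0 ≤ M a i j) (hfair : IsSuperfair M)
    (h : ∀ i : Fin m, ∃ w : List A, HasNonBettingPart M (Pi.single i (1 : ℝ) ᵥ* wordMatrix M w))
    {X : ℕ → A} (hX : IsNormal X) {v : Fin m → ℝ} (hv : 0 ≤ v) :
    (∀ᶠ n in atTop, orbit M v X n = 0) ∨
      ∃ l : ℝ, 0 < l ∧ ExpConvergesTo (fun n => l1Norm (orbit M v X n)) l := by
  obtain ⟨n₀, h0 | ⟨s, hs, hs0, hsv⟩⟩ := orbit_eq_zero_or_hasNonBettingPart hM h hX hv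
  · left
    filter_upwards [eventually_ge_atTop n₀] with n hn
    rw [← Nat.add_sub_cancel' hn, orbit_add, h0, Matrix.zero_vecMul]
  · right
    obtain ⟨l, hl, hexp⟩ := exists_expConvergesTo_of_abs_sub_le
      (u := fun n => l1Norm (orbit M v X n)) (Nat.cast_nonneg (Fintype.card A))
      (fun n => by
        simp only [orbit_succ]
        exact abs_l1Norm_vecMul_sub_le hM hfair (orbit_nonneg hM hv X n) (X n))
      (expConvergesTo_live_orbit hM hfair h hX hv)
    refine ⟨l, ?_, hexp⟩
    refine ((l1Norm_nonneg s).lt_of_ne' (mt l1Norm_eq_zero.1 hs0)).trans_le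
      (ge_of_tendsto hl ?_)
    filter_upwards [eventually_ge_atTop n₀] with n hn
    rw [← Nat.add_sub_cancel' hn, orbit_add,
      ← hs.2 (List.ofFn fun t : Fin (n - n₀) => X (n₀ + t))]
    exact l1Norm_mono (vecMul_nonneg (wordMatrix_nonneg hM _) hs.1)
      (vecMul_mono (wordMatrix_nonneg hM _) hsv)

end MatrixWalk

theorem mainTheorem5 {A : Type*} [Fintype A] [Nonempty A] {m : ℕ}
    (M : A → Matrix (Fin m) (Fin m) ℝ)
    (hnonneg : ∀ a i j, 0 ≤ M a i j)
    (hfair : IsSuperfair M)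
    (hstar : StarCondition M)
    (B : Set (Finset (Fin m))) (hB : IsNonNullBSCC M B)
    (F : Finset (Fin m)) (hF : F ∈ B)
    (w : List A) (hw : PseudoMixes M w F)
    (x : Fin m → ℝ) (hx : IsContractionLimit M F w x)
    (hrisk : ∀ z : List A, risk M (act M x z) = 0) :
    (∀ X : ℕ → A, IsNormal X → ∀ v : Fin m → ℝ, 0 ≤ v →
      ((∀ᶠ n in atTop, orbit M v X n = 0) ∨
        ∃ l : ℝ, 0 < l ∧ ExpConvergesTo (fun n => l1Norm (orbit M v X n)) l)) ∧
    (∃ v : Fin m → ℝ, 0 ≤ v ∧ ∀ X : ℕ → A, IsNormal X →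
      ∃ l : ℝ, 0 < l ∧ ExpConvergesTo (fun n => l1Norm (orbit M v X n)) l) ∧
    (∀ X : ℕ → A, IsNormal X → ∀ v : Fin m → ℝ, 0 ≤ v →
      ExpConvergesTo (fun n => live M (orbit M v X n)) 0) := by
  have hx0 : x ≠ 0 := fun h0 => by
    have h1 := hx.1.2.1
    rw [l1Norm_eq_zero.2 h0] at h1
    exact zero_ne_one h1
  have : Nonempty (Fin m) := ⟨(Function.ne_iff.1 hx0).choose⟩
  have hxS : x ∈ nonBetting M :=
    mem_nonBetting_of_risk hnonneg hfair hx.1.1 hx.1.2.1 hrisk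
  have hword := exists_word_hasNonBettingPart hnonneg hstar hxS hx0
    (by rw [hx.1.2.2]; exact hB.2.1 hF)
  refine ⟨fun X hX v hv => orbit_eventually_zero_or_expConvergesTo hnonneg hfair hword hX hv,
    ⟨x, hxS.1, fun X hX => ⟨1, one_pos, 1, one_pos, ?_⟩⟩,
    fun X hX v hv => expConvergesTo_live_orbit hnonneg hfair hword hX hv⟩
  have hconst : ∀ n, l1Norm (orbit M x X n) - 1 = 0 := fun n => by
    rw [orbit, hxS.2, hx.1.2.1, sub_self]
  simp only [hconst]
  exact isBigO_zero _ _
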